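/- Let $\mathcal{G}=(V,\mathcal{E})$ be a finite hypergraph (every hyperedge has at least two vertices; parallel hyperedges are allowed), let $k$ be a positive integer, $K=\{1,\dots,k\}$, and let $\ell,\ell':K\cup\{0\}\to\mathbb{Z}_{>0}$ satisfy $$\ell'(K)\ \ge\ \ell'(0)\ \ge\ \ell(0)\ \ge\ \ell(K)\qquad\text{and}\qquad |V|\ \ge\ \ell'(i)\ \ge\ \ell(i)\quad\text{for every } 1\le i\le k,$$ where $m(K)=\sum_{i=1}^k m(i)$. For an integer $p$ put $m_p(i)=\min\{m(i),p\}$. For a partition $\mathcal{P}$ of $V$ let $e_{\mathcal{E}}(\mathcal{P})$ be the number of hyperedges that enter some member of $\mathcal{P}$, where a hyperedge enters $X\subseteq V$ if it has a vertex in $X$ and a vertex in $V\setminus X$. A digraph $(U,F)$ is an $S$-branching if $S\subseteq U$ and every $u\in U$ is reached from $S$ along exactly one directed walk, the trivial walk being allowed (equivalently: roots in $S$ have in-degree $0$, all other vertices have in-degree $1$, and there is no directed cycle). Orienting a hyperedge means choosing one of its vertices as head, the others becoming tails; trimming a hyperarc means replacing it by an arc from one of its tails to its head. A directed hypergraph $\mathcal{B}$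 is an $S$-hyperbranching if $S$ is a set of vertices of $\mathcal{B}$ and its hyperarcs can be trimmed to an arc set $F$ such that $(C,F)$ is an $S$-branching, where the core $C$ consists of $S$ and of all vertices that are the head of at least one hyperarc of $\mathcal{B}$. A subhypergraph $\mathcal{T}$ of $\mathcal{G}$ is a spanning $S$-hyperforest if it can be oriented to an $S$-hyperbranching with core $V$. A packing is a family of such subhypergraphs that are pairwise hyperedge-disjoint. Then there exist sets $S_1,\dots,S_k\subseteq V$ and a packing of $k$ spanning $S_i$-hyperforests $B_i$ $(1\le i\le k)$ in $\mathcal{G}$ such that $$\ell(i)\le |S_i|\le \ell'(i)\quad\text{for every } 1\le i\le k,\qquad \ell(0)\le\sum_{i=1}^k|S_i|\le\ell'(0)$$ if and only if $$\ell'(0)-\ell(K)+\ell_{|\mathcal{P}|}(K)+e_{\mathcal{E}}(\mathcal{P})\ \ge\ k|\mathcal{P}|\quad\text{for every partition }\mathcal{P}\text{ of }V,$$ $$\ell'_{|\mathcal{P}|}(K)+e_{\mathcal{E}}(\mathcal{P})\ \ge\ k|\mathcal{P}|\quad\text{for every partition }\mathcal{P}\text{ of }V.$$ -/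

import Mathlib

/-- A finite hypergraph `(V, 𝓔)` with vertices from `V` and hyperedges named by elements of `E`.
Distinct names may have the same set of ends, so parallel hyperedges are allowed. Only the values
`ends e` with `e ∈ edges` matter. -/
structure MultiHypergraph (V E : Type*) where
  verts : Finset V
  edges : Finset E
  ends : E → Finset V
  ends_subset : ∀ e ∈ edges, ends e ⊆ verts
  two_le_card : ∀ e ∈ edges, 2 ≤ (ends e).card

/-- A finite directed hypergraph: every hyperarc has exactly one head and at least one tail,
and the head is not a tail. -/
structure Dypergraph (V A : Type*) where
  verts : Finset V
  arcs : Finset A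
  head : A → V
  tails : A → Finset V
  head_mem : ∀ a ∈ arcs, head a ∈ verts
  tails_subset : ∀ a ∈ arcs, tails a ⊆ verts
  tails_nonempty : ∀ a ∈ arcs, (tails a).Nonempty
  head_notMem_tails : ∀ a ∈ arcs, head a ∉ tails a

/-- In the digraph with arc set `F`, in which `a ∈ F` is an arc from `tail a` to `head a`,
the sequence of arcs `p` leads from `s` to `u`. -/
def IsDipath {V A : Type*} (F : Finset A) (tail head : A → V) : V → List A → V → Prop
  | s, [], u => s = u
  | s, a :: p, u => a ∈ F ∧ tail a = s ∧ IsDipath F tail head (head a) p u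

/-- The digraph `(U, F)`, in which `a ∈ F` is an arc from `tail a` to `head a`, is an
`S`-branching: `S ⊆ U` and every `u ∈ U` is reached from `S` in exactly one way (by one starting
vertex in `S` and one sequence of arcs). Repeated vertices are not excluded in advance: it is the
uniqueness that forces all these sequences to be paths, and that rules out arcs entering a root
or closing a directed cycle. -/
def IsBranching {V A : Type*} (U : Finset V) (F : Finset A) (tail head : A → V)
    (S : Finset V) : Prop :=
  (∀ a ∈ F, tail a ∈ U ∧ head a ∈ U) ∧ S ⊆ U ∧
    ∀ u ∈ U, ∃! p : V × List A, p.1 ∈ S ∧ IsDipath F tail head p.1 p.2 u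

namespace Dypergraph

variable {V A : Type*} [DecidableEq V]

/-- The in-degree of a vertex: the number of hyperarcs with head `v`. -/
def inDegree (B : Dypergraph V A) (v : V) : ℕ :=
  (B.arcs.filter fun a => B.head a = v).card

/-- The core with respect to `S`: the vertices of in-degree at least `1` together with `S`. -/
def core (B : Dypergraph V A) (S : Finset V) : Finset V :=
  (B.verts.filter fun v => 1 ≤ B.inDegree v) ∪ S

/-- `S`-hyperbranching: every hyperarc can be trimmed to an arc from one of its tails to its head
such that the core together with these arcs is an `S`-branching. -/
def IsHyperbranching (B : Dypergraph V A) (S : Finset V) : Prop :=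
  S ⊆ B.verts ∧ ∃ tail : A → V, (∀ a ∈ B.arcs, tail a ∈ B.tails a) ∧
    IsBranching (B.core S) B.arcs tail B.head S

end Dypergraph

namespace MultiHypergraph

variable {V E : Type*}

/-- `T` is a subhypergraph of `G`. -/
def IsSubhypergraph (T G : MultiHypergraph V E) : Prop :=
  T.verts ⊆ G.verts ∧ T.edges ⊆ G.edges ∧ ∀ e ∈ T.edges, T.ends e = G.ends e

variable [DecidableEq V]

/-- `B` arises from `T` by orienting every hyperedge, that is, by choosing one of its vertices
as head, the other ones being the tails. -/
def IsOrientation (T : MultiHypergraph V E) (B : Dypergraph V E) : Prop :=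
  B.verts = T.verts ∧ B.arcs = T.edges ∧
    ∀ e ∈ T.edges, B.head e ∈ T.ends e ∧ B.tails e = (T.ends e).erase (B.head e)

/-- `T` is a spanning `S`-hyperforest in `G`: a subhypergraph that can be oriented to an
`S`-hyperbranching whose core is the whole vertex set of `G`. -/
def IsSpanningHyperforest (G T : MultiHypergraph V E) (S : Finset V) : Prop :=
  T.IsSubhypergraph G ∧ ∃ B : Dypergraph V E, T.IsOrientation B ∧ B.IsHyperbranching S ∧
    B.core S = G.verts

/-- The family `B` of `k` hypergraphs with the family `S` of root sets is a packing of `k`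
spanning `S i`-hyperforests `B i` in `G`. -/
def IsSpanningPacking (G : MultiHypergraph V E) {k : ℕ} (B : Fin k → MultiHypergraph V E)
    (S : Fin k → Finset V) : Prop :=
  (∀ i, G.IsSpanningHyperforest (B i) (S i)) ∧
    ∀ i j, i ≠ j → Disjoint (B i).edges (B j).edges

/-- The hyperedge `e` enters `X`: it has a vertex in `X` and a vertex outside `X`. -/
def Enters (G : MultiHypergraph V E) (e : E) (X : Finset V) : Prop :=
  (G.ends e ∩ X).Nonempty ∧ (G.ends e \ X).Nonempty

open Classical in
/-- The number of hyperedges that enter some member of the partition `P` of the vertex set. -/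
noncomputable def enteringCount (G : MultiHypergraph V E) (P : Finpartition G.verts) : ℕ :=
  (G.edges.filter fun e => ∃ X ∈ P.parts, G.Enters e X).card

end MultiHypergraph

/-- For `m` on `{0, 1, …, k}`, the sum `m(K)` over `K = {1, …, k}`. -/
def sumK {k : ℕ} (m : Fin (k + 1) → ℕ) : ℕ := ∑ i : Fin k, m i.succ

/-- The function `m_p`, with `m_p(i) = min {m(i), p}`. -/
def truncAt {k : ℕ} (m : Fin (k + 1) → ℕ) (p : ℕ) : Fin (k + 1) → ℕ := fun i => min (m i) p

/-!
Necessity: a member of the partition that contains no root of a spanning hyperforest is entered by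
a hyperedge whose head it contains, and different members get different hyperedges.

Sufficiency is an application of Rado's theorem. Its ground set consists of all ways to trim a
hyperedge to a pair of its ends and to put it into one of the `k` forests, and a transversal uses
every hyperedge at most once. A set of pairs of graphic rank `r` on `n` vertices contains a forest
with `n - r` roots: the graphic rank is the dimension of the span of incidence vectors, and a vertex
that is not the representative of its component is joined to a vertex closer to it. So the required
numbers of roots become lower and upper bounds on the `k` ranks and on their sum, which a single
monotone submodular function, the minimum of two sums of truncated ranks, can express. If the
hyperedges of a set `J` are deleted, the classes of the ends modulo the span of the remaining
incidence vectors form a partition which only hyperedges of `J` enter, and the inequality for this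
partition is Rado's condition for `J`.
-/

open Finset

section Submodular

/-- Submodularity of a function on a lattice; it is used for set functions, where `⊔` and `⊓` are
union and intersection. -/
def IsSubmodular {L M : Type*} [Lattice L] [Add M] [LE M] (f : L → M) : Prop :=
  ∀ x y, f (x ⊔ y) + f (x ⊓ y) ≤ f x + f y

namespace IsSubmodular

section OrderedCodomain

variable {L L' M : Type*} [Lattice L] [Lattice L'] [AddCommMonoid M]

theorem const [Preorder M] (c : M) : IsSubmodular fun _ : L => c := fun _ _ => le_rfl

theorem add [Preorder M] [AddLeftMono M] {f g : L → M} (hf : IsSubmodular f)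
    (hg : IsSubmodular g) : IsSubmodular fun x => f x + g x := fun x y => by
  rw [add_add_add_comm, add_add_add_comm (f x)]
  exact add_le_add (hf x y) (hg x y)

theorem sum [PartialOrder M] [IsOrderedAddMonoid M] {ι : Type*} (s : Finset ι) {f : ι → L → M}
    (hf : ∀ i ∈ s, IsSubmodular (f i)) : IsSubmodular fun x => ∑ i ∈ s, f i x := fun x y => by
  simp only [← sum_add_distrib]
  exact sum_le_sum fun i hi => hf i hi x y

theorem comp_of_map_sup [Preorder M] [AddLeftMono M] {f : L' → M} (hf : IsSubmodular f)
    (hm : Monotone f) {g : L → L'} (hg : ∀ x y, g (x ⊔ y) = g x ⊔ g y) :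
    IsSubmodular fun x => f (g x) := fun x y => by
  have hmono : Monotone g := fun x y hxy => by
    rw [← sup_eq_right.2 hxy, hg]
    exact le_sup_left
  have hinf : f (g (x ⊓ y)) ≤ f (g x ⊓ g y) := hm (hmono.map_inf_le x y)
  calc f (g (x ⊔ y)) + f (g (x ⊓ y)) ≤ f (g x ⊔ g y) + f (g x ⊓ g y) := by
        rw [hg]
        gcongr
    _ ≤ f (g x) + f (g y) := hf _ _

variable [LinearOrder M] [IsOrderedCancelAddMonoid M]

/-- `hfg` says that the difference `f - g` is monotone. -/
protected theorem min {f g : L → M} (hf : IsSubmodular f) (hg : IsSubmodular g)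
    (hfg : ∀ ⦃x y⦄, x ≤ y → f x + g y ≤ f y + g x) : IsSubmodular fun x => min (f x) (g x) := by
  have mixed : ∀ x y, g (x ⊔ y) + f (x ⊓ y) ≤ f x + g y := fun x y => by
    refine le_of_add_le_add_right (a := f (x ⊔ y) + f y) ?_
    calc g (x ⊔ y) + f (x ⊓ y) + (f (x ⊔ y) + f y)
        = (f (x ⊔ y) + f (x ⊓ y)) + (f y + g (x ⊔ y)) := by abel
      _ ≤ (f x + f y) + (f (x ⊔ y) + g y) := add_le_add (hf x y) (hfg le_sup_right)
      _ = f x + g y + (f (x ⊔ y) + f y) := by abel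
  intro x y
  beta_reduce
  rcases min_choice (f x) (g x) with hx | hx <;> rcases min_choice (f y) (g y) with hy | hy <;>
    rw [hx, hy]
  · exact (add_le_add (min_le_left _ _) (min_le_left _ _)).trans (hf x y)
  · exact (add_le_add (min_le_right _ _) (min_le_left _ _)).trans (mixed x y)
  · rw [add_comm (g x), sup_comm x, inf_comm x]
    exact (add_le_add (min_le_right _ _) (min_le_left _ _)).trans (mixed y x)
  · exact (add_le_add (min_le_right _ _) (min_le_right _ _)).trans (hg x y)

theorem min_const {f : L → M} (hf : IsSubmodular f) (hm : Monotone f) (c : M) :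
    IsSubmodular fun x => Min.min (f x) c :=
  hf.min (const c) fun _ _ hxy => by gcongr; exact hm hxy

end OrderedCodomain

end IsSubmodular

end Submodular

section Rado

variable {α E : Type*} [DecidableEq E]

/-- The condition of Rado's theorem for a partial transversal of the fibres of `π` in `X` with
`f`-value at least `t`: deleting the fibres over any set `J` lowers the value of `X` to no less
than `t - |J|`. -/
def RadoCondition (f : Finset α → ℕ) (π : α → E) (t : ℕ) (X : Finset α) : Prop :=
  ∀ J : Finset E, t ≤ f {x ∈ X | π x ∉ J} + #J

variable [DecidableEq α] {f : Finset α → ℕ} {π : α → E} {t : ℕ} {X : Finset α}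

theorem RadoCondition.erase_or_erase (hf : IsSubmodular f) (hm : Monotone f)
    (hX : RadoCondition f π t X) {x y : α} (hxy : x ≠ y) (hπ : π x = π y) :
    RadoCondition f π t (X.erase x) ∨ RadoCondition f π t (X.erase y) := by
  by_contra! hcon
  simp only [RadoCondition, not_forall, not_le] at hcon
  obtain ⟨⟨J₁, h₁⟩, J₂, h₂⟩ := hcon
  have notMem_of_lt : ∀ {z J}, f {w ∈ X.erase z | π w ∉ J} + #J < t → π z ∉ J := by
    intro z J hJ hz
    have : {w ∈ X.erase z | π w ∉ J} = {w ∈ X | π w ∉ J} := by grind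
    exact hJ.not_ge (this ▸ hX J)
  have hJ₁ : π x ∉ J₁ := notMem_of_lt h₁
  have hJ₂ : π x ∉ J₂ := hπ ▸ notMem_of_lt h₂
  have hunion : {z ∈ X | π z ∉ J₁ ∩ J₂} ⊆
      {z ∈ X.erase x | π z ∉ J₁} ∪ {z ∈ X.erase y | π z ∉ J₂} := by
    intro z hz
    grind
  have hinter : {z ∈ X | π z ∉ insert (π x) (J₁ ∪ J₂)} ⊆
      {z ∈ X.erase x | π z ∉ J₁} ∩ {z ∈ X.erase y | π z ∉ J₂} := by
    intro z hz
    grind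
  have hcard : #(insert (π x) (J₁ ∪ J₂)) = #(J₁ ∪ J₂) + 1 :=
    card_insert_of_notMem (by simp [hJ₁, hJ₂])
  have hcards := card_union_add_card_inter J₁ J₂
  have hsub := hf {z ∈ X.erase x | π z ∉ J₁} {z ∈ X.erase y | π z ∉ J₂}
  have hu := (hX (J₁ ∩ J₂)).trans (add_le_add_left (hm hunion) _)
  have hi := (hX (insert (π x) (J₁ ∪ J₂))).trans (add_le_add_left (hm hinter) _)
  simp only [sup_eq_union, inf_eq_inter] at hsub
  omega

theorem RadoCondition.exists_transversal (hf : IsSubmodular f) (hm : Monotone f)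
    (hX : RadoCondition f π t X) : ∃ Y ⊆ X, Set.InjOn π Y ∧ t ≤ f Y := by
  induction X using Finset.strongInduction with
  | H X ih =>
    by_cases hinj : Set.InjOn π X
    · exact ⟨X, Subset.rfl, hinj, by simpa using hX ∅⟩
    · obtain ⟨x, hx, y, hy, hπ, hxy⟩ : ∃ x ∈ X, ∃ y ∈ X, π x = π y ∧ x ≠ y := by
        simpa [Set.InjOn] using hinj
      obtain ⟨z, hz, hXz⟩ : ∃ z ∈ X, RadoCondition f π t (X.erase z) :=
        (hX.erase_or_erase hf hm hxy hπ).elim (⟨x, hx, ·⟩) (⟨y, hy, ·⟩)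
      obtain ⟨Y, hYX, hY⟩ := ih _ (erase_ssubset hz) hXz
      exact ⟨Y, hYX.trans (erase_subset _ _), hY⟩

theorem exists_between_sum_eq {ι : Type*} [Fintype ι] {a b : ι → ℕ} {t : ℕ}
    (hab : a ≤ b) (ha : ∑ i, a i ≤ t) (hb : t ≤ ∑ i, b i) :
    ∃ d : ι → ℕ, a ≤ d ∧ d ≤ b ∧ ∑ i, d i = t := by
  classical
  induction t, ha using Nat.le_induction with
  | base => exact ⟨a, le_rfl, hab, rfl⟩
  | succ t _ ih =>
    obtain ⟨d, had, hdb, hd⟩ := ih (by omega)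
    obtain ⟨i, -, hi⟩ := exists_lt_of_sum_lt (s := univ) (f := d) (g := b) (by omega)
    refine ⟨d + Pi.single i 1, had.trans le_self_add, fun j => ?_, ?_⟩
    · obtain rfl | hji := eq_or_ne j i
      · simpa using hi
      · simpa [hji] using hdb j
    · simp [sum_add_distrib, hd]

section SumMin

variable {ι L : Type*} [Fintype ι] [Lattice L] {r : ι → L → ℕ}

theorem monotone_sum_min (hm : ∀ i, Monotone (r i)) (c : ι → ℕ) :
    Monotone fun x => ∑ i, min (r i x) (c i) := fun _ _ hxy =>
  sum_le_sum fun i _ => min_le_min_right _ (hm i hxy)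

theorem isSubmodular_sum_min (hr : ∀ i, IsSubmodular (r i)) (hm : ∀ i, Monotone (r i))
    (c : ι → ℕ) : IsSubmodular fun x => ∑ i, min (r i x) (c i) :=
  .sum _ fun i _ => (hr i).min_const (hm i) _

theorem sum_min_add_sum_min_le (hm : ∀ i, Monotone (r i)) {a b : ι → ℕ} (hab : a ≤ b) {x y : L}
    (hxy : x ≤ y) : ∑ i, min (r i x) (b i) + ∑ i, min (r i y) (a i) ≤
      ∑ i, min (r i y) (b i) + ∑ i, min (r i x) (a i) := by
  simp only [← sum_add_distrib]
  refine sum_le_sum fun i _ => ?_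
  have hri : r i x ≤ r i y := hm i hxy
  have habi : a i ≤ b i := hab i
  omega

end SumMin

/-- Rado's theorem is applied to the smaller one of `∑ i, min (r i) (b i)` and
`∑ i, min (r i) (a i) + (t - ∑ i, a i)`: the first bound leaves room for a total of `t`, the
second one forces `a i ≤ r i` for every `i`. -/
theorem exists_transversal_between {ι : Type*} [Fintype ι] {r : ι → Finset α → ℕ}
    (hr : ∀ i, IsSubmodular (r i)) (hm : ∀ i, Monotone (r i)) {a b : ι → ℕ} (hab : a ≤ b)
    (ht : ∑ i, a i ≤ t) (hb : RadoCondition (fun Y => ∑ i, min (r i Y) (b i)) π t X)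
    (ha : RadoCondition (fun Y => ∑ i, min (r i Y) (a i)) π (∑ i, a i) X) :
    ∃ Y ⊆ X, Set.InjOn π Y ∧ ∃ d : ι → ℕ,
      a ≤ d ∧ d ≤ b ∧ (∀ i, d i ≤ r i Y) ∧ ∑ i, d i = t := by
  have hsub : IsSubmodular fun Y =>
      min (∑ i, min (r i Y) (b i)) (∑ i, min (r i Y) (a i) + (t - ∑ i, a i)) :=
    (isSubmodular_sum_min hr hm b).min ((isSubmodular_sum_min hr hm a).add (.const _))
      fun Y Z hYZ => by
        have := sum_min_add_sum_min_le hm hab hYZ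
        omega
  have hmono : Monotone fun Y =>
      min (∑ i, min (r i Y) (b i)) (∑ i, min (r i Y) (a i) + (t - ∑ i, a i)) :=
    (monotone_sum_min hm b).min ((monotone_sum_min hm a).add_const _)
  obtain ⟨Y, hYX, hinj, hY⟩ := RadoCondition.exists_transversal (π := π) (t := t) (X := X)
    hsub hmono fun J => by
      have := ha J
      have := hb J
      grind
  have har : ∀ i, a i ≤ r i Y := fun i => min_eq_right_iff.1 <|
    (sum_eq_sum_iff_of_le fun i _ => min_le_right (r i Y) (a i)).1
      (le_antisymm (sum_le_sum fun i _ => min_le_right _ _) (by omega)) i (mem_univ i)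
  obtain ⟨d, had, hd, hsum⟩ := exists_between_sum_eq (b := fun i => min (r i Y) (b i))
    (fun i => le_min (har i) (hab i)) ht (hY.trans (min_le_left _ _))
  exact ⟨Y, hYX, hinj, d, had, fun i => (hd i).trans (min_le_right _ _),
    fun i => (hd i).trans (min_le_left _ _), hsum⟩

end Rado

section GraphicRank

variable {V : Type*}

/-- The row of the arc `x` in the incidence matrix of the complete digraph on `V`. -/
noncomputable def incidenceVector (x : V × V) : V →₀ ℚ := .single x.1 1 - .single x.2 1

/-- The span of the incidence vectors of the arcs in `F`, that is, the flat spanned by `F` in the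
linear representation of the cycle matroid. -/
noncomputable def incidenceSpan (F : Finset (V × V)) : Submodule ℚ (V →₀ ℚ) :=
  Submodule.span ℚ (incidenceVector '' F)

instance incidenceSpan.finiteDimensional (F : Finset (V × V)) :
    FiniteDimensional ℚ (incidenceSpan F) :=
  .span_of_finite ℚ (F.finite_toSet.image _)

/-- The rank of `F` in the cycle matroid of the complete graph on `V`, computed from its linear
representation over `ℚ`. -/
noncomputable def graphicRank (F : Finset (V × V)) : ℕ := Module.finrank ℚ (incidenceSpan F)

theorem incidenceVector_mem_incidenceSpan {F : Finset (V × V)} {x : V × V} (hx : x ∈ F) :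
    incidenceVector x ∈ incidenceSpan F :=
  Submodule.subset_span (Set.mem_image_of_mem _ hx)

theorem incidenceSpan_mono : Monotone (incidenceSpan (V := V)) := fun _ _ h =>
  Submodule.span_mono (Set.image_mono (coe_subset.2 h))

theorem graphicRank_mono : Monotone (graphicRank (V := V)) := fun _ _ h =>
  Submodule.finrank_mono (incidenceSpan_mono h)

theorem isSubmodular_graphicRank [DecidableEq V] : IsSubmodular (graphicRank (V := V)) := by
  intro F F'
  have hsup : incidenceSpan (F ⊔ F') = incidenceSpan F ⊔ incidenceSpan F' := by
    simp only [incidenceSpan, sup_eq_union, coe_union, Set.image_union, Submodule.span_union]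
  have hinf : incidenceSpan (F ⊓ F') ≤ incidenceSpan F ⊓ incidenceSpan F' :=
    incidenceSpan_mono.map_inf_le F F'
  calc graphicRank (F ⊔ F') + graphicRank (F ⊓ F')
      ≤ Module.finrank ℚ ↥(incidenceSpan F ⊔ incidenceSpan F') +
          Module.finrank ℚ ↥(incidenceSpan F ⊓ incidenceSpan F') := by
        rw [graphicRank, hsup]
        exact Nat.add_le_add_left (Submodule.finrank_mono hinf) _
    _ = graphicRank F + graphicRank F' := Submodule.finrank_sup_add_finrank_inf_eq _ _

theorem finrank_span_single_image (U : Finset V) :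
    Module.finrank ℚ (Submodule.span ℚ ((Finsupp.single · (1 : ℚ)) '' (U : Set V))) = #U := by
  have hli : LinearIndependent ℚ fun v : U => Finsupp.single (v : V) (1 : ℚ) :=
    (Finsupp.linearIndependent_single_one ℚ V).comp _ Subtype.val_injective
  rw [Set.image_eq_range]
  exact (finrank_span_eq_card hli).trans (Fintype.card_coe U)

theorem card_le_graphicRank_add_card_parts [DecidableEq V] {U : Finset V} (P : Finpartition U)
    {F : Finset (V × V)}
    (hP : ∀ X ∈ P.parts, ∀ u ∈ X, ∀ v ∈ X, incidenceVector (u, v) ∈ incidenceSpan F) :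
    #U ≤ graphicRank F + #P.parts := by
  choose rep hrep using fun X : P.parts => P.nonempty_of_mem_parts X.2
  let δ : V → V →₀ ℚ := fun v => .single v 1
  have hspan : Submodule.span ℚ (δ '' U) ≤
      incidenceSpan F ⊔ Submodule.span ℚ (Set.range (δ ∘ rep)) := by
    rw [Submodule.span_le]
    rintro _ ⟨v, hv, rfl⟩
    obtain ⟨X, hX, hvX⟩ := P.exists_mem hv
    rw [← sub_add_cancel (δ v) (δ (rep ⟨X, hX⟩))]
    exact Submodule.add_mem_sup (hP X hX v hvX _ (hrep ⟨X, hX⟩))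
      (Submodule.subset_span (Set.mem_range_self _))
  have := FiniteDimensional.span_of_finite ℚ (Set.finite_range (δ ∘ rep))
  calc #U = Module.finrank ℚ (Submodule.span ℚ (δ '' U)) := (finrank_span_single_image U).symm
    _ ≤ Module.finrank ℚ ↥(incidenceSpan F ⊔ Submodule.span ℚ (Set.range (δ ∘ rep))) :=
        Submodule.finrank_mono hspan
    _ ≤ graphicRank F + Module.finrank ℚ (Submodule.span ℚ (Set.range (δ ∘ rep))) :=
        Submodule.finrank_add_le_finrank_add_finrank _ _
    _ ≤ graphicRank F + #P.parts := by
        gcongr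
        exact (finrank_range_le_card (δ ∘ rep)).trans_eq (Fintype.card_coe _)

theorem exists_finpartition_incidenceSpan [DecidableEq V] (U : Finset V) (F : Finset (V × V)) :
    ∃ P : Finpartition U, ∀ X ∈ P.parts, ∀ u ∈ X, ∀ v ∈ U,
      v ∈ X ↔ incidenceVector (u, v) ∈ incidenceSpan F := by
  classical
  let s : Setoid V := Setoid.ker fun v => (incidenceSpan F).mkQ (.single v 1)
  have hs : ∀ u v, s u v ↔ incidenceVector (u, v) ∈ incidenceSpan F := fun u v =>
    Submodule.Quotient.eq _
  refine ⟨Finpartition.ofSetSetoid s U, fun X hX u hu v hv => ?_⟩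
  obtain ⟨a, -, rfl⟩ := mem_image.1 hX
  have hau : s a u := (mem_filter.1 hu).2
  rw [← hs, mem_filter, and_iff_right hv]
  exact ⟨s.trans (s.symm hau), s.trans hau⟩

end GraphicRank

section Forest

variable {V : Type*}

theorem exists_root_height (H : SimpleGraph V) : ∃ (root : V → V) (height : V → ℕ),
    (∀ u v, H.Adj u v → root u = root v) ∧
      ∀ v, v ≠ root v → ∃ u, H.Adj u v ∧ height u < height v := by
  let root : V → V := fun v => (H.connectedComponentMk v).out
  have reachable_root : ∀ v, H.Reachable v (root v) := fun v =>
    (SimpleGraph.ConnectedComponent.exact (Quot.out_eq (H.connectedComponentMk v))).symm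
  have root_eq : ∀ u v, H.Adj u v → root u = root v := fun u v huv =>
    congrArg Quot.out (SimpleGraph.ConnectedComponent.sound huv.reachable)
  refine ⟨root, fun v => H.dist v (root v), root_eq, fun v hv => ?_⟩
  obtain ⟨p, hp⟩ := (reachable_root v).exists_walk_length_eq_dist
  obtain ⟨u, hvu, q, rfl⟩ := SimpleGraph.Walk.exists_eq_cons_of_ne hv p
  refine ⟨u, hvu.symm, ?_⟩
  calc H.dist u (root u) = H.dist u (root v) := by rw [root_eq u v hvu.symm]
    _ ≤ q.length := H.dist_le q
    _ < H.dist v (root v) := by rw [← hp, SimpleGraph.Walk.length_cons]; exact q.length.lt_succ_self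

/-- The incidence vectors of `F` lie in the span of the `δ v - δ (root v)` with `v ≠ root v`, where
`root v` is a representative of the component of `v`. -/
theorem exists_graphicRank_le_card (F : Finset (V × V)) :
    ∃ (N : Finset V) (height : V → ℕ), graphicRank F ≤ #N ∧
      ∀ v ∈ N, ∃ u, ((u, v) ∈ F ∨ (v, u) ∈ F) ∧ height u < height v := by
  classical
  obtain ⟨root, height, root_eq, hheight⟩ :=
    exists_root_height (SimpleGraph.fromRel fun u v => (u, v) ∈ F)
  have root_eq_of_mem : ∀ x ∈ F, root x.1 = root x.2 := fun x hx => by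
    by_cases hne : x.1 = x.2
    · rw [hne]
    · exact root_eq _ _ ⟨hne, .inl hx⟩
  let N : Finset V := {v ∈ F.image Prod.fst ∪ F.image Prod.snd | v ≠ root v}
  let β : V → V →₀ ℚ := fun v => incidenceVector (v, root v)
  have mem_span : ∀ v ∈ F.image Prod.fst ∪ F.image Prod.snd, β v ∈ Submodule.span ℚ (β '' N) := by
    intro v hv
    by_cases hvr : v = root v
    · have : β v = 0 := by simp [β, incidenceVector, ← hvr]
      exact this ▸ zero_mem _
    · exact Submodule.subset_span (Set.mem_image_of_mem _ (mem_filter.2 ⟨hv, hvr⟩))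
  have hspan : incidenceSpan F ≤ Submodule.span ℚ (β '' N) := by
    rw [incidenceSpan, Submodule.span_le]
    rintro _ ⟨x, hx, rfl⟩
    have : incidenceVector x = β x.1 - β x.2 := by
      simp [β, incidenceVector, root_eq_of_mem x hx]
    rw [this]
    exact sub_mem (mem_span _ (mem_union_left _ (mem_image_of_mem _ hx)))
      (mem_span _ (mem_union_right _ (mem_image_of_mem _ hx)))
  refine ⟨N, height, ?_, fun v hv => ?_⟩
  · have := FiniteDimensional.span_of_finite ℚ (N.finite_toSet.image β)
    calc graphicRank F ≤ Module.finrank ℚ (Submodule.span ℚ (β '' N)) :=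
          Submodule.finrank_mono hspan
      _ ≤ #N := by
        rw [Set.image_eq_range]
        exact (finrank_range_le_card (fun v : N => β v)).trans_eq (Fintype.card_coe N)
  · obtain ⟨u, huv, hu⟩ := hheight v (mem_filter.1 hv).2
    exact ⟨u, huv.2, hu⟩

end Forest

section Branching

variable {V A : Type*} {F : Finset A} {tail head : A → V}

theorem isDipath_append_singleton {s u : V} {p : List A} {a : A} :
    IsDipath F tail head s (p ++ [a]) u ↔
      IsDipath F tail head s p (tail a) ∧ a ∈ F ∧ head a = u := by
  induction p generalizing s with
  | nil =>
    simp only [List.nil_append, IsDipath]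
    grind
  | cons b p ih => simp only [List.cons_append, IsDipath, ih, and_assoc]

theorem IsDipath.exists_entering {X : Set V} {s u : V} {p : List A}
    (h : IsDipath F tail head s p u) (hs : s ∉ X) (hu : u ∈ X) :
    ∃ a ∈ F, tail a ∉ X ∧ head a ∈ X := by
  induction p generalizing s with
  | nil => exact absurd (h ▸ hu) hs
  | cons a p ih =>
    obtain ⟨ha, rfl, hp⟩ := h
    by_cases hX : head a ∈ X
    · exact ⟨a, ha, hs, hX⟩
    · exact ih hp hX

theorem IsDipath.eq_of_injOn_head (hinj : Set.InjOn head F) {s s' u : V} {p p' : List A}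
    (hs : s ∉ head '' F) (hs' : s' ∉ head '' F) (hp : IsDipath F tail head s p u)
    (hp' : IsDipath F tail head s' p' u) : s = s' ∧ p = p' := by
  induction p using List.reverseRecOn generalizing u p' with
  | nil =>
    obtain rfl : s = u := hp
    cases p' using List.reverseRecOn with
    | nil => exact ⟨hp'.symm, rfl⟩
    | append_singleton q b =>
      obtain ⟨-, hb, hbs⟩ := isDipath_append_singleton.1 hp'
      exact absurd ⟨b, hb, hbs⟩ hs
  | append_singleton p a ih =>
    obtain ⟨hpa, ha, rfl⟩ := isDipath_append_singleton.1 hp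
    cases p' using List.reverseRecOn with
    | nil => exact absurd ⟨a, ha, hp'.symm⟩ hs'
    | append_singleton q b =>
      obtain ⟨hq, hb, hba⟩ := isDipath_append_singleton.1 hp'
      obtain rfl := hinj hb ha hba
      obtain ⟨rfl, rfl⟩ := ih hpa hq
      exact ⟨rfl, rfl⟩

theorem exists_isDipath_of_height (height : V → ℕ)
    (hheight : ∀ a ∈ F, height (tail a) < height (head a)) (u : V) :
    ∃ s p, (s = u ∨ s ∈ tail '' F) ∧ s ∉ head '' F ∧ IsDipath F tail head s p u := by
  induction hn : height u using Nat.strong_induction_on generalizing u with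
  | _ n ih =>
    by_cases hu : u ∈ head '' F
    · obtain ⟨a, ha, rfl⟩ := hu
      obtain ⟨s, p, hsa, hs, hp⟩ := ih _ (hn ▸ hheight a ha) (tail a) rfl
      have hsF : s ∈ tail '' F := hsa.elim (fun h => ⟨a, ha, h.symm⟩) id
      exact ⟨s, p ++ [a], .inr hsF, hs, isDipath_append_singleton.2 ⟨hp, ha, rfl⟩⟩
    · exact ⟨u, [], .inl rfl, hu, rfl⟩

theorem isBranching_of_height [DecidableEq V] {U : Finset V}
    (hU : ∀ a ∈ F, tail a ∈ U ∧ head a ∈ U) (hinj : Set.InjOn head F) (height : V → ℕ)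
    (hheight : ∀ a ∈ F, height (tail a) < height (head a)) :
    IsBranching U F tail head (U \ F.image head) := by
  have mem_roots {s : V} : s ∈ U \ F.image head ↔ s ∈ U ∧ s ∉ head '' F := by
    rw [mem_sdiff, ← mem_coe (s := F.image head), coe_image]
  refine ⟨hU, sdiff_subset, fun u hu => ?_⟩
  obtain ⟨s, p, hsu, hs, hp⟩ := exists_isDipath_of_height height hheight u
  have hsU : s ∈ U := by
    obtain rfl | ⟨a, ha, rfl⟩ := hsu
    exacts [hu, (hU a ha).1]
  refine ⟨(s, p), ⟨mem_roots.2 ⟨hsU, hs⟩, hp⟩, ?_⟩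
  rintro ⟨s', p'⟩ ⟨hs', hp'⟩
  exact Prod.ext_iff.2 (hp'.eq_of_injOn_head hinj (mem_roots.1 hs').2 hs hp)

end Branching

theorem card_le_card_of_subset_parts {α β : Type*} [DecidableEq α] {s : Finset α}
    (P : Finpartition s) {Q : Finset (Finset α)} (hQ : Q ⊆ P.parts) {B : Finset β} (f : β → α)
    (h : ∀ X ∈ Q, ∃ b ∈ B, f b ∈ X) : #Q ≤ #B :=
  card_le_card_of_forall_subsingleton (fun X b => f b ∈ X) h fun _ _ _ hX _ hY =>
    P.eq_of_mem_parts (hQ hX.1) (hQ hY.1) hX.2 hY.2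

namespace MultiHypergraph

variable {V E : Type*} [DecidableEq V] {G T : MultiHypergraph V E} {S : Finset V}

theorem IsSpanningHyperforest.exists_head (h : G.IsSpanningHyperforest T S) :
    ∃ head : E → V, ∀ X ⊆ G.verts, X.Nonempty → Disjoint X S →
      ∃ e ∈ T.edges, head e ∈ X ∧ G.Enters e X := by
  obtain ⟨⟨-, -, hends⟩, B, ⟨-, harcs, hor⟩, ⟨-, tail, htail, -, -, hbr⟩, hcore⟩ := h
  refine ⟨B.head, fun X hXG ⟨u, hu⟩ hXS => ?_⟩
  obtain ⟨⟨s, p⟩, ⟨hs, hp⟩, -⟩ := hbr u (hcore ▸ hXG hu)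
  obtain ⟨a, ha, htX, hhX⟩ := hp.exists_entering (X := X) (disjoint_right.1 hXS hs) hu
  have haT : a ∈ T.edges := harcs ▸ ha
  obtain ⟨hhead, htails⟩ := hor a haT
  have htail_mem : tail a ∈ T.ends a := mem_of_mem_erase (htails ▸ htail a ha)
  rw [hends a haT] at hhead htail_mem
  exact ⟨a, haT, hhX, ⟨_, mem_inter.2 ⟨hhead, hhX⟩⟩, ⟨_, mem_sdiff.2 ⟨htail_mem, htX⟩⟩⟩

open Classical in
theorem IsSpanningHyperforest.card_parts_le (h : G.IsSpanningHyperforest T S)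
    (P : Finpartition G.verts) :
    #P.parts ≤ min #P.parts #S + #{e ∈ T.edges | ∃ X ∈ P.parts, G.Enters e X} := by
  obtain ⟨head, hhead⟩ := h.exists_head
  have hmeet : #{X ∈ P.parts | ¬ Disjoint X S} ≤ #S :=
    card_le_card_of_subset_parts P (filter_subset _ _) id fun X hX => by
      obtain ⟨v, hvX, hvS⟩ := not_disjoint_iff.1 (mem_filter.1 hX).2
      exact ⟨v, hvS, hvX⟩
  have havoid : #{X ∈ P.parts | Disjoint X S} ≤
      #{e ∈ T.edges | ∃ X ∈ P.parts, G.Enters e X} :=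
    card_le_card_of_subset_parts P (filter_subset _ _) head fun X hX => by
      obtain ⟨hXP, hXS⟩ := mem_filter.1 hX
      obtain ⟨e, he, heX, hent⟩ := hhead X (P.le hXP) (P.nonempty_of_mem_parts hXP) hXS
      exact ⟨e, mem_filter.2 ⟨he, X, hXP, hent⟩, heX⟩
  have hsplit := card_filter_add_card_filter_not (s := P.parts) fun X => Disjoint X S
  omega

theorem IsSpanningPacking.mul_card_parts_le {k : ℕ} {B : Fin k → MultiHypergraph V E}
    {S : Fin k → Finset V} (h : G.IsSpanningPacking B S) (P : Finpartition G.verts) :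
    k * #P.parts ≤ ∑ i, min #P.parts #(S i) + G.enteringCount P := by
  classical
  have hentering : ∑ i, #{e ∈ (B i).edges | ∃ X ∈ P.parts, G.Enters e X} ≤ G.enteringCount P := by
    rw [← card_biUnion fun i _ j _ hij => disjoint_filter_filter (h.2 i j hij)]
    exact card_le_card <| biUnion_subset.2 fun i _ => filter_subset_filter _ (h.1 i).1.2.1
  calc k * #P.parts = ∑ _i : Fin k, #P.parts := by simp
    _ ≤ ∑ i, (min #P.parts #(S i) + #{e ∈ (B i).edges | ∃ X ∈ P.parts, G.Enters e X}) :=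
        sum_le_sum fun i _ => (h.1 i).card_parts_le P
    _ ≤ ∑ i, min #P.parts #(S i) + G.enteringCount P := by
        rw [sum_add_distrib]
        gcongr

theorem IsSpanningPacking.mul_card_parts_add_le {k : ℕ} {B : Fin k → MultiHypergraph V E}
    {S : Fin k → Finset V} (h : G.IsSpanningPacking B S) {a : Fin k → ℕ} (ha : ∀ i, a i ≤ #(S i))
    (P : Finpartition G.verts) :
    k * #P.parts + ∑ i, a i ≤ ∑ i, #(S i) + ∑ i, min (a i) #P.parts + G.enteringCount P := by
  have hterm : ∑ i, min #P.parts #(S i) + ∑ i, a i ≤ ∑ i, #(S i) + ∑ i, min (a i) #P.parts := by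
    simp only [← sum_add_distrib]
    refine sum_le_sum fun i _ => ?_
    have := ha i
    omega
  have := h.mul_card_parts_le P
  omega

end MultiHypergraph

namespace MultiHypergraph

variable {V E : Type*}

/-- The subhypergraph of `G` on all vertices with the hyperedges in `F`. -/
def restrict (G : MultiHypergraph V E) (F : Finset E) (hF : F ⊆ G.edges) :
    MultiHypergraph V E where
  verts := G.verts
  edges := F
  ends := G.ends
  ends_subset e he := G.ends_subset e (hF he)
  two_le_card e he := G.two_le_card e (hF he)

variable [DecidableEq V]

/-- The orientation of `T` in which the hyperedge `e` has the head `head e`. -/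
def orient (T : MultiHypergraph V E) (head : E → V) (hhead : ∀ e ∈ T.edges, head e ∈ T.ends e) :
    Dypergraph V E where
  verts := T.verts
  arcs := T.edges
  head := head
  tails e := (T.ends e).erase (head e)
  head_mem e he := T.ends_subset e he (hhead e he)
  tails_subset e he := (erase_subset _ _).trans (T.ends_subset e he)
  tails_nonempty e he := card_pos.1 <| by
    have := T.two_le_card e he
    rw [card_erase_of_mem (hhead e he)]
    omega
  head_notMem_tails _ _ := notMem_erase _ _

theorem isOrientation_orient (T : MultiHypergraph V E) (head : E → V)
    (hhead : ∀ e ∈ T.edges, head e ∈ T.ends e) : T.IsOrientation (T.orient head hhead) :=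
  ⟨rfl, rfl, fun e he => ⟨hhead e he, rfl⟩⟩

theorem core_orient (T : MultiHypergraph V E) (head : E → V)
    (hhead : ∀ e ∈ T.edges, head e ∈ T.ends e) (S : Finset V) :
    (T.orient head hhead).core S = T.edges.image head ∪ S := by
  have hverts : T.edges.image head ⊆ T.verts :=
    image_subset_iff.2 fun e he => T.ends_subset e he (hhead e he)
  rw [Dypergraph.core, ← inter_eq_right.2 hverts, ← filter_mem_eq_inter]
  congr 1
  refine filter_congr fun v _ => ?_
  rw [Dypergraph.inDegree, Nat.one_le_iff_ne_zero, card_ne_zero, filter_nonempty_iff, mem_image]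
  rfl

theorem isSpanningHyperforest_restrict (G : MultiHypergraph V E) {F : Finset E}
    (hF : F ⊆ G.edges) {tail head : E → V} (htail : ∀ e ∈ F, tail e ∈ G.ends e)
    (hhead : ∀ e ∈ F, head e ∈ G.ends e) (hinj : Set.InjOn head F) (height : V → ℕ)
    (hheight : ∀ e ∈ F, height (tail e) < height (head e)) :
    G.IsSpanningHyperforest (G.restrict F hF) (G.verts \ F.image head) := by
  have hends : ∀ e ∈ F, tail e ∈ G.verts ∧ head e ∈ G.verts := fun e he =>
    ⟨G.ends_subset e (hF he) (htail e he), G.ends_subset e (hF he) (hhead e he)⟩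
  have hcore : ((G.restrict F hF).orient head hhead).core (G.verts \ F.image head) = G.verts :=
    (core_orient _ head hhead _).trans <|
      union_sdiff_of_subset (image_subset_iff.2 fun e he => (hends e he).2)
  refine ⟨⟨Subset.rfl, hF, fun _ _ => rfl⟩, _, isOrientation_orient _ head hhead,
    ⟨sdiff_subset, tail, fun e he => ?_, ?_⟩, hcore⟩
  · exact mem_erase.2 ⟨ne_of_apply_ne height (hheight e he).ne, htail e he⟩
  · rw [hcore]
    exact isBranching_of_height hends hinj height hheight

theorem exists_isSpanningHyperforest [Nonempty V] (G : MultiHypergraph V E) {N : Finset V}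
    (edge : N → E) (hinj : Function.Injective edge) (height : V → ℕ)
    (hedge : ∀ v, edge v ∈ G.edges ∧ ↑v ∈ G.ends (edge v) ∧
      ∃ u ∈ G.ends (edge v), height u < height v) :
    ∃ T, (∀ e ∈ T.edges, ∃ v, edge v = e) ∧ G.IsSpanningHyperforest T (G.verts \ N) := by
  classical
  choose hedges hends u hu hlt using hedge
  let head : E → V := Function.extend edge Subtype.val fun _ => Classical.arbitrary V
  let tail : E → V := Function.extend edge u fun _ => Classical.arbitrary V
  have head_edge : ∀ v, head (edge v) = v := hinj.extend_apply _ _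
  have tail_edge : ∀ v, tail (edge v) = u v := hinj.extend_apply _ _
  have forall_image {p : E → Prop} : (∀ e ∈ univ.image edge, p e) ↔ ∀ v, p (edge v) := by
    simp only [forall_mem_image, mem_univ, true_imp_iff]
  have hF : univ.image edge ⊆ G.edges := forall_image.2 hedges
  have hheads : Set.InjOn head (univ.image edge) := by
    rw [coe_image, coe_univ, Set.image_univ]
    rintro _ ⟨v, rfl⟩ _ ⟨w, rfl⟩ hvw
    rw [head_edge, head_edge] at hvw
    rw [Subtype.ext hvw]
  have image_head : (univ.image edge).image head = N := by
    ext v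
    simp [head_edge]
  have hforest := G.isSpanningHyperforest_restrict hF (tail := tail)
    (forall_image.2 fun v => (tail_edge v).symm ▸ hu v)
    (forall_image.2 fun v => (head_edge v).symm ▸ hends v) hheads height
    (forall_image.2 fun v => by rw [head_edge, tail_edge]; exact hlt v)
  rw [image_head] at hforest
  exact ⟨_, forall_image.2 fun v => ⟨v, rfl⟩, hforest⟩

end MultiHypergraph

theorem sum_min_tsub_add {ι : Type*} [Fintype ι] {n p : ℕ} (hp : p ≤ n) {m : ι → ℕ}
    (hm : ∀ i, m i ≤ n) :
    ∑ i, min (n - p) (n - m i) + ∑ i, m i + Fintype.card ι * p =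
      Fintype.card ι * n + ∑ i, min (m i) p := by
  have hsum : ∑ i, (min (n - p) (n - m i) + m i + p) = ∑ i, (n + min (m i) p) :=
    sum_congr rfl fun i _ => by
      have := hm i
      omega
  simpa [sum_add_distrib] using hsum

namespace MultiHypergraph

variable {V E ι : Type*} [DecidableEq V]

/-- The arcs obtained by orienting and trimming hyperedges of `J`, and the loops at their ends. -/
def endPairs (G : MultiHypergraph V E) (J : Finset E) : Finset (V × V) :=
  J.biUnion fun e => G.ends e ×ˢ G.ends e

theorem exists_finpartition_card_le_graphicRank [DecidableEq E] (G : MultiHypergraph V E)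
    (J : Finset E) : ∃ P : Finpartition G.verts, G.enteringCount P ≤ #J ∧
      #G.verts ≤ graphicRank (G.endPairs (G.edges \ J)) + #P.parts := by
  classical
  obtain ⟨P, hP⟩ := exists_finpartition_incidenceSpan G.verts (G.endPairs (G.edges \ J))
  refine ⟨P, card_le_card fun e he => ?_, card_le_graphicRank_add_card_parts P
    fun X hX u hu v hv => (hP X hX u hu v (P.le hX hv)).1 hv⟩
  obtain ⟨heG, X, hX, ⟨u, hu⟩, v, hv⟩ := mem_filter.1 he
  obtain ⟨hue, huX⟩ := mem_inter.1 hu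
  obtain ⟨hve, hvX⟩ := mem_sdiff.1 hv
  by_contra heJ
  have huv : (u, v) ∈ G.endPairs (G.edges \ J) :=
    mem_biUnion.2 ⟨e, mem_sdiff.2 ⟨heG, heJ⟩, mem_product.2 ⟨hue, hve⟩⟩
  exact hvX ((hP X hX u huX v (G.ends_subset e heG hve)).2 (incidenceVector_mem_incidenceSpan huv))

/-- The ground set for Rado's theorem: `(e, i, u, v)` stands for trimming the hyperedge `e` of `G`
to the pair `u, v` of its ends and putting it into the forest with index `i`. -/
def trimmings (G : MultiHypergraph V E) (ι : Type*) [Fintype ι] : Finset (E × ι × V × V) :=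
  {x ∈ G.edges ×ˢ univ ×ˢ G.verts ×ˢ G.verts | x.2.2.1 ∈ G.ends x.1 ∧ x.2.2.2 ∈ G.ends x.1}

theorem mem_trimmings [Fintype ι] {G : MultiHypergraph V E} {x : E × ι × V × V} :
    x ∈ G.trimmings ι ↔ x.1 ∈ G.edges ∧ x.2.2.1 ∈ G.ends x.1 ∧ x.2.2.2 ∈ G.ends x.1 := by
  simp only [trimmings, mem_filter, mem_product, mem_univ, true_and]
  exact ⟨fun h => ⟨h.1.1, h.2⟩, fun h =>
    ⟨⟨h.1, G.ends_subset _ h.1 h.2.1, G.ends_subset _ h.1 h.2.2⟩, h.2⟩⟩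

variable [DecidableEq ι]

/-- The arcs of the forest with index `i` in a set of trimmings. -/
def colorArcs (i : ι) (Y : Finset (E × ι × V × V)) : Finset (V × V) :=
  {x ∈ Y | x.2.1 = i}.image fun x => x.2.2

theorem mem_colorArcs {i : ι} {Y : Finset (E × ι × V × V)} {p : V × V} :
    p ∈ colorArcs i Y ↔ ∃ e, (e, i, p) ∈ Y := by
  simp [colorArcs]

theorem colorArcs_mono (i : ι) : Monotone (colorArcs (V := V) (E := E) i) := fun _ _ h =>
  image_subset_image (filter_subset_filter _ h)

theorem monotone_graphicRank_colorArcs (i : ι) :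
    Monotone fun Y : Finset (E × ι × V × V) => graphicRank (colorArcs i Y) :=
  graphicRank_mono.comp (colorArcs_mono i)

theorem isSubmodular_graphicRank_colorArcs [DecidableEq E] (i : ι) :
    IsSubmodular fun Y : Finset (E × ι × V × V) => graphicRank (colorArcs i Y) :=
  isSubmodular_graphicRank.comp_of_map_sup graphicRank_mono fun Y Z => by
    simp only [colorArcs, sup_eq_union, filter_union, image_union]

theorem endPairs_subset_colorArcs [Fintype ι] [DecidableEq E] (G : MultiHypergraph V E)
    (J : Finset E) (i : ι) :
    G.endPairs (G.edges \ J) ⊆ colorArcs i {x ∈ G.trimmings ι | x.1 ∉ J} := by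
  intro p hp
  obtain ⟨e, he, hpe⟩ := mem_biUnion.1 hp
  obtain ⟨heG, heJ⟩ := mem_sdiff.1 he
  exact mem_colorArcs.2 ⟨e, mem_filter.2 ⟨mem_trimmings.2 ⟨heG, mem_product.1 hpe⟩, heJ⟩⟩

theorem exists_isSpanningHyperforest_of_le_graphicRank [Nonempty V] [Fintype ι]
    (G : MultiHypergraph V E) {Y : Finset (E × ι × V × V)} (hY : Y ⊆ G.trimmings ι)
    (hinj : Set.InjOn Prod.fst (Y : Set (E × ι × V × V))) {i : ι} {d : ℕ}
    (hd : d ≤ graphicRank (colorArcs i Y)) :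
    ∃ T S, G.IsSpanningHyperforest T S ∧ #S + d = #G.verts ∧
      ∀ e ∈ T.edges, ∃ x ∈ Y, x.1 = e ∧ x.2.1 = i := by
  obtain ⟨N', height, hN', hparent⟩ := exists_graphicRank_le_card (colorArcs i Y)
  obtain ⟨N, hN, rfl⟩ := exists_subset_card_eq (hd.trans hN')
  have exists_trimming : ∀ v : N, ∃ e p, (e, i, p) ∈ Y ∧
      (p.2 = ↑v ∧ height p.1 < height v ∨ p.1 = ↑v ∧ height p.2 < height v) := fun v => by
    obtain ⟨u, huv | hvu, hlt⟩ := hparent v (hN v.2)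
    · obtain ⟨e, he⟩ := mem_colorArcs.1 huv
      exact ⟨e, _, he, .inl ⟨rfl, hlt⟩⟩
    · obtain ⟨e, he⟩ := mem_colorArcs.1 hvu
      exact ⟨e, _, he, .inr ⟨rfl, hlt⟩⟩
  choose edge p hpY hp using exists_trimming
  have hends : ∀ v, edge v ∈ G.edges ∧ (p v).1 ∈ G.ends (edge v) ∧ (p v).2 ∈ G.ends (edge v) :=
    fun v => mem_trimmings.1 (hY (hpY v))
  have edge_injective : Function.Injective edge := fun v w hvw => by
    have hpvw : p v = p w := congrArg (·.2.2) (hinj (hpY v) (hpY w) hvw)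
    have := hp v
    have := hp w
    grind
  have hedge : ∀ v, edge v ∈ G.edges ∧ ↑v ∈ G.ends (edge v) ∧
      ∃ u ∈ G.ends (edge v), height u < height v := fun v => by
    obtain ⟨he, h₁, h₂⟩ := hends v
    obtain ⟨hv, hlt⟩ | ⟨hv, hlt⟩ := hp v
    · exact ⟨he, hv ▸ h₂, _, h₁, hlt⟩
    · exact ⟨he, hv ▸ h₁, _, h₂, hlt⟩
  obtain ⟨T, hT, hforest⟩ := G.exists_isSpanningHyperforest edge edge_injective height hedge
  have hNG : N ⊆ G.verts := fun v hv =>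
    G.ends_subset _ (hedge ⟨v, hv⟩).1 (hedge ⟨v, hv⟩).2.1
  refine ⟨T, _, hforest, card_sdiff_add_card_eq_card hNG, fun e he => ?_⟩
  obtain ⟨v, rfl⟩ := hT e he
  exact ⟨_, hpY v, rfl, rfl⟩

theorem radoCondition_trimmings [Fintype ι] [DecidableEq E] (G : MultiHypergraph V E) {c : ι → ℕ}
    {t : ℕ} (h : ∀ P : Finpartition G.verts,
      t ≤ ∑ i, min (#G.verts - #P.parts) (c i) + G.enteringCount P) :
    RadoCondition (fun Y => ∑ i, min (graphicRank (colorArcs i Y)) (c i)) Prod.fst t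
      (G.trimmings ι) := by
  intro J
  obtain ⟨P, hPJ, hP⟩ := G.exists_finpartition_card_le_graphicRank J
  have hrank : ∀ i : ι, #G.verts - #P.parts ≤
      graphicRank (colorArcs i {x ∈ G.trimmings ι | x.1 ∉ J}) := fun i =>
    (Nat.sub_le_of_le_add hP).trans (graphicRank_mono (G.endPairs_subset_colorArcs J i))
  calc t ≤ ∑ i, min (#G.verts - #P.parts) (c i) + G.enteringCount P := h P
    _ ≤ _ := Nat.add_le_add (sum_le_sum fun i _ => min_le_min_right _ (hrank i)) hPJ

theorem exists_isSpanningPacking_of_transversal [Nonempty V]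
    (G : MultiHypergraph V E) {k : ℕ} {Y : Finset (E × Fin k × V × V)}
    (hY : Y ⊆ G.trimmings (Fin k)) (hinj : Set.InjOn Prod.fst (Y : Set (E × Fin k × V × V)))
    {d : Fin k → ℕ} (hd : ∀ i, d i ≤ graphicRank (colorArcs i Y)) :
    ∃ (B : Fin k → MultiHypergraph V E) (S : Fin k → Finset V),
      G.IsSpanningPacking B S ∧ ∀ i, #(S i) + d i = #G.verts := by
  choose B S hforest hcard htrim using fun i =>
    G.exists_isSpanningHyperforest_of_le_graphicRank hY hinj (hd i)
  refine ⟨B, S, ⟨hforest, fun i j hij => disjoint_left.2 fun e hei hej => hij ?_⟩, hcard⟩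
  obtain ⟨x, hx, hxe, rfl⟩ := htrim i e hei
  obtain ⟨y, hy, hye, rfl⟩ := htrim j e hej
  rw [hinj hx hy (hxe.trans hye.symm)]

/-- Bounds `a i ≤ |S i| ≤ b i` on the numbers of roots are bounds `|V| - b i` and `|V| - a i` on
the sizes of the forests. -/
theorem exists_isSpanningPacking [Nonempty V] (G : MultiHypergraph V E) {k : ℕ} {a b : Fin k → ℕ}
    {t : ℕ} (hab : a ≤ b) (hb : ∀ i, b i ≤ #G.verts) (ht : t ≤ ∑ i, b i)
    (ha_part : ∀ P : Finpartition G.verts,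
      k * #P.parts + ∑ i, a i ≤ t + ∑ i, min (a i) #P.parts + G.enteringCount P)
    (hb_part : ∀ P : Finpartition G.verts,
      k * #P.parts ≤ ∑ i, min (b i) #P.parts + G.enteringCount P) :
    ∃ (B : Fin k → MultiHypergraph V E) (S : Fin k → Finset V), G.IsSpanningPacking B S ∧
      (∀ i, a i ≤ #(S i) ∧ #(S i) ≤ b i) ∧ ∑ i, #(S i) = t := by
  classical
  have ha : ∀ i, a i ≤ #G.verts := fun i => (hab i).trans (hb i)
  have sum_tsub_b : ∑ i, (#G.verts - b i) + ∑ i, b i = k * #G.verts := by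
    rw [← sum_add_distrib, sum_congr rfl fun i _ => Nat.sub_add_cancel (hb i)]
    simp
  have rado_a := G.radoCondition_trimmings (ι := Fin k) (c := fun i => #G.verts - a i)
    (t := k * #G.verts - t) fun P => by
      have := ha_part P
      have := sum_min_tsub_add P.card_parts_le_card ha
      rw [Fintype.card_fin] at this
      omega
  have rado_b := G.radoCondition_trimmings (ι := Fin k) (c := fun i => #G.verts - b i)
    (t := ∑ i, (#G.verts - b i)) fun P => by
      have := hb_part P
      have := sum_min_tsub_add P.card_parts_le_card hb
      rw [Fintype.card_fin] at this
      omega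
  obtain ⟨Y, hY, hinj, d, hbd, hda, hd, hsum⟩ :=
    exists_transversal_between isSubmodular_graphicRank_colorArcs monotone_graphicRank_colorArcs
      (fun i => Nat.sub_le_sub_left (hab i) _) (by omega) rado_a rado_b
  obtain ⟨B, S, hBS, hcard⟩ := G.exists_isSpanningPacking_of_transversal hY hinj hd
  refine ⟨B, S, hBS, fun i => ?_, ?_⟩
  · have := hcard i
    have hbdi : #G.verts - b i ≤ d i := hbd i
    have hdai : d i ≤ #G.verts - a i := hda i
    have := hb i
    have := ha i
    omega
  · have hsum_card : ∑ i, #(S i) + ∑ i, d i = k * #G.verts := by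
      simp [← sum_add_distrib, hcard]
    omega

end MultiHypergraph

theorem sumK_add_sumK_truncAt_le {k n p : ℕ} {m m' : Fin (k + 1) → ℕ}
    (hm : ∀ i : Fin k, m i.succ ≤ n ∧ m i.succ ≤ m' i.succ) (hp : p ≤ n) :
    sumK m + sumK (truncAt m' p) ≤ sumK (truncAt m' n) + sumK (truncAt m p) := by
  simp only [sumK, truncAt, ← sum_add_distrib]
  refine sum_le_sum fun i _ => ?_
  have := hm i
  omega

theorem mainTheorem6_general {V E : Type*} [DecidableEq V] [Nonempty V] (G : MultiHypergraph V E)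
    {k : ℕ} (ℓ ℓ' : Fin (k + 1) → ℕ)
    (htotal : ℓ 0 ≤ ℓ' 0 ∧ ℓ 0 ≤ sumK (truncAt ℓ' #G.verts))
    (heach : ∀ i : Fin k, ℓ i.succ ≤ #G.verts ∧ ℓ i.succ ≤ ℓ' i.succ) :
    (∃ (B : Fin k → MultiHypergraph V E) (S : Fin k → Finset V),
      G.IsSpanningPacking B S ∧
      (∀ i : Fin k, ℓ i.succ ≤ #(S i) ∧ #(S i) ≤ ℓ' i.succ) ∧
      ℓ 0 ≤ ∑ i, #(S i) ∧ ∑ i, #(S i) ≤ ℓ' 0) ↔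
    ((∀ P : Finpartition G.verts,
        (k : ℤ) * #P.parts ≤
          (ℓ' 0 : ℤ) - sumK ℓ + sumK (truncAt ℓ #P.parts) + G.enteringCount P) ∧
      ∀ P : Finpartition G.verts,
        (k : ℤ) * #P.parts ≤ (sumK (truncAt ℓ' #P.parts) : ℤ) + G.enteringCount P) := by
  have part_iff : ∀ P : Finpartition G.verts,
      (k : ℤ) * #P.parts ≤ (ℓ' 0 : ℤ) - sumK ℓ + sumK (truncAt ℓ #P.parts) + G.enteringCount P ↔
        k * #P.parts + sumK ℓ ≤ ℓ' 0 + sumK (truncAt ℓ #P.parts) + G.enteringCount P := by omega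
  have part_iff' : ∀ P : Finpartition G.verts,
      (k : ℤ) * #P.parts ≤ (sumK (truncAt ℓ' #P.parts) : ℤ) + G.enteringCount P ↔
        k * #P.parts ≤ sumK (truncAt ℓ' #P.parts) + G.enteringCount P := by omega
  simp only [part_iff, part_iff']
  constructor
  · rintro ⟨B, S, hBS, hS, -, hS'⟩
    refine ⟨fun P => ?_, fun P => ?_⟩
    · exact (hBS.mul_card_parts_add_le (fun i => (hS i).1) P).trans (by gcongr; rfl)
    · refine (hBS.mul_card_parts_le P).trans (Nat.add_le_add_right (sum_le_sum fun i _ => ?_) _)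
      rw [min_comm]
      exact min_le_min_right _ (hS i).2
  · rintro ⟨h, h'⟩
    obtain ⟨B, S, hBS, hS, hsum⟩ := G.exists_isSpanningPacking (a := fun i => ℓ i.succ)
      (b := fun i => min (ℓ' i.succ) #G.verts) (t := min (ℓ' 0) (sumK (truncAt ℓ' #G.verts)))
      (fun i => le_min (heach i).2 (heach i).1) (fun i => min_le_right _ _) (min_le_right _ _)
      (fun P => by
        have := sumK_add_sumK_truncAt_le heach P.card_parts_le_card
        have := h P
        have := h' P
        change k * #P.parts + sumK ℓ ≤ _ + sumK (truncAt ℓ #P.parts) + G.enteringCount P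
        omega)
      (fun P => by simpa [sumK, truncAt, min_assoc, P.card_parts_le_card] using h' P)
    exact ⟨B, S, hBS, fun i => ⟨(hS i).1, (hS i).2.trans (min_le_left _ _)⟩,
      hsum ▸ le_min htotal.1 htotal.2, hsum ▸ min_le_left _ _⟩

theorem mainTheorem6 {V E : Type*} [DecidableEq V] (G : MultiHypergraph V E)
    (k : ℕ) (hk : 0 < k) (ℓ ℓ' : Fin (k + 1) → ℕ)
    (hpos : ∀ i, 0 < ℓ i) (hpos' : ∀ i, 0 < ℓ' i)
    (htotal : ℓ' 0 ≤ sumK ℓ' ∧ ℓ 0 ≤ ℓ' 0 ∧ sumK ℓ ≤ ℓ 0)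
    (heach : ∀ i : Fin k, ℓ' i.succ ≤ G.verts.card ∧ ℓ i.succ ≤ ℓ' i.succ) :
    (∃ (B : Fin k → MultiHypergraph V E) (S : Fin k → Finset V),
      G.IsSpanningPacking B S ∧
      (∀ i : Fin k, ℓ i.succ ≤ (S i).card ∧ (S i).card ≤ ℓ' i.succ) ∧
      ℓ 0 ≤ ∑ i, (S i).card ∧ ∑ i, (S i).card ≤ ℓ' 0) ↔
    ((∀ P : Finpartition G.verts,
        (k : ℤ) * P.parts.card ≤
          (ℓ' 0 : ℤ) - sumK ℓ + sumK (truncAt ℓ P.parts.card) + G.enteringCount P) ∧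
      ∀ P : Finpartition G.verts,
        (k : ℤ) * P.parts.card ≤
          (sumK (truncAt ℓ' P.parts.card) : ℤ) + G.enteringCount P) := by
  have : Nonempty V := (card_pos.1 ((hpos' _).trans_le (heach ⟨0, hk⟩).1)).to_type
  have hsum : sumK ℓ' ≤ sumK (truncAt ℓ' #G.verts) :=
    sum_le_sum fun i _ => le_min le_rfl (heach i).1
  exact mainTheorem6_general G ℓ ℓ' ⟨htotal.2.1, htotal.2.1.trans (htotal.1.trans hsum)⟩
    fun i => ⟨(heach i).2.trans (heach i).1, (heach i).2⟩
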